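/- **Consistency of the maximum-likelihood estimator of the connectivity matrix in the stochastic block model.** Fix an integer $Q$ and constants $\zeta>0$ and $0<\gamma<1/Q$. Let $\mathcal{S}_\gamma$ be the set of vectors $\alpha=(\alpha_1,\dots,\alpha_Q)$ with $\sum_q\alpha_q=1$ and - (A3) $\alpha_q\in[\gamma,1-\gamma]$ for every $q$, and let $\Pi_\zeta$ be the set of matrices $\pi\in[0,1]^{Q\times Q}$ such that - (A1) for every $q\neq q'$ there is $l$ with $\pi_{q,l}\neq\pi_{q',l}$ or $\pi_{l,q}\neq\pi_{l,q'}$; - (A2) for all $q,l$, $\pi_{q,l}\in(0,1)$ implies $\pi_{q,l}\in[\zeta,1-\zeta]$. Let $(\alpha^*,\pi^*)\in\mathcal{S}_\gamma\times\Pi_\zeta$ be the true parameter. Let $(Z_i)_{i\ge1}$ be i.i.d. labels with $\mathbb{P}(Z_i=q)=\alpha^*_q$, and let $X=(X_{i,j})_{i,j\geq 1}$ be a random binary matrix with $X_{i,i}=0$ such that, for every $n$, conditionally on $(Z_1,\dots,Z_n)$, the variables $X_{i,j}$ with $1\le i\ne j\le n$ are independent Bernoulli variables with parameters $\pi^*_{Z_i,Z_j}$.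 The graph $X_{[n]}=(X_{i,j})_{1\le i,j\le n}$ is observed. With the conventions $\log 0=-\infty$, $0\log 0=0$, $e^{-\infty}=0$, set $$\mathcal{L}_1(X_{[n]};z,\pi)=\sum_{1\le i\neq j\le n}\bigl\{X_{i,j}\log\pi_{z_i,z_j}+(1-X_{i,j})\log(1-\pi_{z_i,z_j})\bigr\},$$ $$\mathcal{L}_2(X_{[n]};\alpha,\pi)=\log\Bigl(\sum_{z\in\{1,\dots,Q\}^n}e^{\mathcal{L}_1(X_{[n]};z,\pi)}\prod_{i=1}^n\alpha_{z_i}\Bigr).$$ A maximum-likelihood estimator (MLE) is $$(\widehat\alpha,\widehat\pi)\in\operatorname*{arg\,max}_{(\alpha,\pi)\in\mathcal{S}_\gamma\times\Pi_\zeta}\mathcal{L}_2(X_{[n]};\alpha,\pi),$$ chosen arbitrarily among the maximizers if there are several, and defined arbitrarily if there is none. Then the probability that a maximizer exists tends to $1$ as $n\to\infty$, and for every choice of the MLE and every distance $d$ on $\Pi_\zeta$ that is continuous for the usual topology of $\mathbb{R}^{Q\times Q}$, $\widehat\pi$ is consistent up to label switching: $$\min_{\sigma\in\mathfrak{S}_Q}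 d\bigl(\widehat\pi^{\sigma},\pi^*\bigr)\xrightarrow[n\to\infty]{\mathbb{P}}0,\qquad\text{where }\widehat\pi^{\sigma}_{q,l}=\widehat\pi_{\sigma(q),\sigma(l)}.$$ -/

import Mathlib

open MeasureTheory ProbabilityTheory Filter Topology

/-- The law of a stochastic block model on the infinite vertex set `ℕ`, with `Q` classes, class
proportions `α` and (directed, binary) connectivity matrix `π`.  The labels `Z i` are i.i.d. with
`P(Z i = q) = α q`, there are no loops, and conditionally on the labels `Z 0 = z 0, …, Z (n-1) =
z (n-1)` the edge variables `X i j` (`i ≠ j`, `i, j < n`) are independent Bernoulli variables with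
parameters `π (z i) (z j)`. -/
structure IsSBM {Ω : Type*} [MeasurableSpace Ω] (μ : Measure Ω) {Q : ℕ}
    (α : Fin Q → ℝ) (π : Matrix (Fin Q) (Fin Q) ℝ)
    (Z : ℕ → Ω → Fin Q) (X : ℕ → ℕ → Ω → Bool) : Prop where
  measurable_label : ∀ i, Measurable (Z i)
  measurable_edge : ∀ i j, Measurable (X i j)
  label_indep : iIndepFun Z μ
  label_law : ∀ i q, μ {ω | Z i ω = q} = ENNReal.ofReal (α q)
  no_loop : ∀ i ω, X i i ω = false
  edge_law : ∀ (n : ℕ) (z : Fin n → Fin Q) (x : Fin n → Fin n → Bool), (∀ i, x i i = false) →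
    μ {ω | (∀ i : Fin n, Z i ω = z i) ∧ ∀ i j : Fin n, X i j ω = x i j} =
      μ {ω | ∀ i : Fin n, Z i ω = z i} *
        ∏ p ∈ (Finset.univ : Finset (Fin n)).offDiag,
          ENNReal.ofReal (if x p.1 p.2 then π (z p.1) (z p.2) else 1 - π (z p.1) (z p.2))

/-- The conditional log-likelihood
`∑_{i ≠ j} x_{ij} log π_{z_i z_j} + (1 - x_{ij}) log (1 - π_{z_i z_j})`, with values in
`[-∞, 0]` for `π` with entries in `[0, 1]` (conventions `log 0 = -∞` and `0 log 0 = 0`). -/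
noncomputable def condLogLik {Q n : ℕ} (x : Fin n → Fin n → Bool) (z : Fin n → Fin Q)
    (π : Matrix (Fin Q) (Fin Q) ℝ) : EReal :=
  ∑ p ∈ (Finset.univ : Finset (Fin n)).offDiag,
    if x p.1 p.2 then ENNReal.log (ENNReal.ofReal (π (z p.1) (z p.2)))
    else ENNReal.log (ENNReal.ofReal (1 - π (z p.1) (z p.2)))

/-- The log-likelihood `log (∑_z exp (condLogLik x z π) ∏_i α_{z_i})` of the observed adjacency
matrix `x` of the first `n` vertices, with values in `[-∞, 0]` on the parameter set. -/
noncomputable def logLik {Q n : ℕ} (x : Fin n → Fin n → Bool)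
    (θ : (Fin Q → ℝ) × Matrix (Fin Q) (Fin Q) ℝ) : EReal :=
  ENNReal.log (∑ z : Fin n → Fin Q,
    EReal.exp (condLogLik x z θ.2) * ∏ i, ENNReal.ofReal (θ.1 (z i)))

/-- The connectivity matrices: entries in `[0, 1]`, no two classes have the same connectivity
profile, and every entry different from `0` and `1` lies in `[ζ, 1 - ζ]`. -/
def connectivitySet (Q : ℕ) (ζ : ℝ) : Set (Matrix (Fin Q) (Fin Q) ℝ) :=
  {π | (∀ q l, 0 ≤ π q l ∧ π q l ≤ 1) ∧
    (∀ q q', q ≠ q' → ∃ l, π q l ≠ π q' l ∨ π l q ≠ π l q') ∧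
    (∀ q l, 0 < π q l → π q l < 1 → ζ ≤ π q l ∧ π q l ≤ 1 - ζ)}

/-- The vectors of class proportions: probability vectors with all entries in `[γ, 1 - γ]`. -/
def proportionSet (Q : ℕ) (γ : ℝ) : Set (Fin Q → ℝ) :=
  {α | ∑ q, α q = 1 ∧ ∀ q, γ ≤ α q ∧ α q ≤ 1 - γ}

/-- The set of maximum-likelihood estimates for the observation `x`: the maximizers of the
log-likelihood over the parameter set. -/
def mleSet {Q n : ℕ} (ζ γ : ℝ) (x : Fin n → Fin n → Bool) :
    Set ((Fin Q → ℝ) × Matrix (Fin Q) (Fin Q) ℝ) :=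
  {θ | θ ∈ proportionSet Q γ ×ˢ connectivitySet Q ζ ∧
    ∀ θ' ∈ proportionSet Q γ ×ˢ connectivitySet Q ζ, logLik x θ' ≤ logLik x θ}

/-- The restriction of `d` to the set `S` is a distance on `S`. -/
structure IsDistanceOn {E : Type*} (S : Set E) (d : E → E → ℝ) : Prop where
  nonneg : ∀ x ∈ S, ∀ y ∈ S, 0 ≤ d x y
  eq_zero_iff : ∀ x ∈ S, ∀ y ∈ S, d x y = 0 ↔ x = y
  symm : ∀ x ∈ S, ∀ y ∈ S, d x y = d y x
  triangle : ∀ x ∈ S, ∀ y ∈ S, ∀ w ∈ S, d x w ≤ d x y + d y w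

/-!
Consistency rests on comparing every competitor `(α, π)` with the true parameter `(αs, πs)` and the
true labels `zs`. The likelihood is at least `γ ^ n` times the conditional likelihood of
`(zs, πs)` at the true parameter, and at a competitor it is an average of conditional likelihoods,
hence at most that of `(z, π)` for some labels `z`. So it suffices to show that, with probability
tending to one, no pair `(z, π)` with `π` away from the permutations of `πs` has a conditional
likelihood larger than `γ ^ n` times that of `(zs, πs)`.

* For one pair, a Chernoff bound of order `1 / 2` turns this probability into a Hellinger affinity,
  a product over the edges, so that zero probabilities need no separate treatment
  (`sum_sqrt_condLik_mul_le`, `sum_condLik_filter_le`). It is at most `exp (-D / 2)`, where `D` is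
  the squared distance between the edge probabilities.
* `D` is of order `n²` as soon as every true class has order `n` vertices, which the law of large
  numbers provides: by the pigeonhole principle each true class `q` shares order `n` vertices with
  some class `f q` of `z`, and no map `f` brings `π` close to `πs`, because a map that is not
  injective merges two classes with distinct profiles (`le_sum_sq_of_mem_farMatrices`,
  `exists_perm_of_notMem_farMatrices`).
* The union bound runs over the `Q ^ n` labels `z` and a finite net of matrices `π`, and `exp (O(n))` terms
  do not compensate `exp (-c n²)`. Nets exist because the matrices, without the condition of
  distinct profiles, form a compact set, on which close matrices have conditional likelihoods
  within a factor `exp (c' n²)` with `c'` small (`condLik_le_mul`).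

The likelihood also has a maximizer over the compact relaxed set. By the same bound it is close
to a permutation of `πs`, so its classes have distinct profiles and it is a maximum-likelihood
estimate; this gives existence.
-/

/-! ### Likelihoods as real numbers -/

/-- The probability that a Bernoulli variable of parameter `a` takes the value `b`. -/
def bernoulliMass (b : Bool) (a : ℝ) : ℝ := if b then a else 1 - a

/-- The conditional likelihood of the graph `x` given the labels `z`, as a real number. -/
def condLik {Q n : ℕ} (x : Fin n → Fin n → Bool) (z : Fin n → Fin Q)
    (π : Matrix (Fin Q) (Fin Q) ℝ) : ℝ :=
  ∏ p ∈ (Finset.univ : Finset (Fin n)).offDiag, bernoulliMass (x p.1 p.2) (π (z p.1) (z p.2))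

/-- The likelihood of the graph `x`, as a real number. -/
def lik {Q n : ℕ} (x : Fin n → Fin n → Bool)
    (θ : (Fin Q → ℝ) × Matrix (Fin Q) (Fin Q) ℝ) : ℝ :=
  ∑ z : Fin n → Fin Q, condLik x z θ.2 * ∏ i, θ.1 (z i)

/-- The connectivity matrices without the requirement that classes have distinct profiles: a
compact set, which contains `connectivitySet Q ζ`. -/
def relaxedConnectivitySet (Q : ℕ) (ζ : ℝ) : Set (Matrix (Fin Q) (Fin Q) ℝ) :=
  {π | ∀ q l, π q l ∈ ({0, 1} : Set ℝ) ∪ Set.Icc ζ (1 - ζ)}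

lemma mem_Icc_of_mem_relaxedConnectivitySet {Q : ℕ} {ζ : ℝ} (hζ : 0 < ζ)
    {π : Matrix (Fin Q) (Fin Q) ℝ} (h : π ∈ relaxedConnectivitySet Q ζ) (q l : Fin Q) :
    π q l ∈ Set.Icc (0 : ℝ) 1 := by
  rcases h q l with (h | h) | h
  · simp [h]
  · rw [Set.mem_singleton_iff] at h; simp [h]
  · exact ⟨by linarith [h.1], by linarith [h.2]⟩

lemma mem_connectivitySet_iff {Q : ℕ} {ζ : ℝ} (hζ : 0 < ζ) {π : Matrix (Fin Q) (Fin Q) ℝ} :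
    π ∈ connectivitySet Q ζ ↔ π ∈ relaxedConnectivitySet Q ζ ∧
      ∀ q q', q ≠ q' → ∃ l, π q l ≠ π q' l ∨ π l q ≠ π l q' := by
  constructor
  · rintro ⟨h01, hsep, hA2⟩
    refine ⟨fun q l => ?_, hsep⟩
    rcases (h01 q l).1.eq_or_lt with h0 | h0
    · exact Or.inl (Or.inl h0.symm)
    rcases (h01 q l).2.eq_or_lt with h1 | h1
    · exact Or.inl (Or.inr h1)
    · exact Or.inr (hA2 q l h0 h1)
  · rintro ⟨h, hsep⟩
    refine ⟨fun q l => mem_Icc_of_mem_relaxedConnectivitySet hζ h q l, hsep, fun q l h0 h1 => ?_⟩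
    rcases h q l with (h | h) | h
    · exact absurd h h0.ne'
    · exact absurd h h1.ne
    · exact h

lemma isCompact_relaxedConnectivitySet (Q : ℕ) (ζ : ℝ) :
    IsCompact (relaxedConnectivitySet Q ζ) := by
  have h : IsCompact (({0, 1} : Set ℝ) ∪ Set.Icc ζ (1 - ζ)) :=
    (Set.toFinite _).isCompact.union isCompact_Icc
  have h2 := isCompact_univ_pi (fun _ : Fin Q => isCompact_univ_pi (fun _ : Fin Q => h))
  have heq : relaxedConnectivitySet Q ζ = Set.pi Set.univ fun _ : Fin Q =>
      Set.pi Set.univ fun _ : Fin Q => ({0, 1} : Set ℝ) ∪ Set.Icc ζ (1 - ζ) :=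
    Set.ext fun π => ⟨fun hπ q _ l _ => hπ q l, fun hπ q l => hπ q trivial l trivial⟩
  rw [heq]
  exact h2

lemma isCompact_proportionSet (Q : ℕ) (γ : ℝ) : IsCompact (proportionSet Q γ) := by
  have h := isCompact_univ_pi (fun _ : Fin Q => isCompact_Icc (a := γ) (b := 1 - γ))
  have hc : IsClosed {α : Fin Q → ℝ | ∑ q, α q = 1} :=
    isClosed_eq (by fun_prop) continuous_const
  convert h.inter_left hc using 1
  ext α
  simp only [proportionSet, Set.mem_inter_iff, Set.mem_ofPred_eq, Set.mem_pi, Set.mem_univ,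
    true_imp_iff, Set.mem_Icc]

lemma bernoulliMass_nonneg (b : Bool) {a : ℝ} (h : a ∈ Set.Icc (0 : ℝ) 1) :
    0 ≤ bernoulliMass b a := by
  unfold bernoulliMass; split_ifs <;> linarith [h.1, h.2]

lemma condLik_nonneg {Q n : ℕ} {π : Matrix (Fin Q) (Fin Q) ℝ}
    (h : ∀ q l, π q l ∈ Set.Icc (0 : ℝ) 1) (x : Fin n → Fin n → Bool) (z : Fin n → Fin Q) :
    0 ≤ condLik x z π :=
  Finset.prod_nonneg fun _ _ => bernoulliMass_nonneg _ (h _ _)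

lemma EReal.exp_sum {ι : Type*} (s : Finset ι) (f : ι → EReal) :
    EReal.exp (∑ i ∈ s, f i) = ∏ i ∈ s, EReal.exp (f i) := by
  classical
  induction s using Finset.induction_on with
  | empty => simp
  | insert a s ha ih => rw [Finset.sum_insert ha, Finset.prod_insert ha, EReal.exp_add, ih]

lemma exp_condLogLik {Q n : ℕ} {π : Matrix (Fin Q) (Fin Q) ℝ}
    (h : ∀ q l, π q l ∈ Set.Icc (0 : ℝ) 1) (x : Fin n → Fin n → Bool) (z : Fin n → Fin Q) :
    EReal.exp (condLogLik x z π) = ENNReal.ofReal (condLik x z π) := by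
  unfold condLogLik condLik
  rw [EReal.exp_sum, ENNReal.ofReal_prod_of_nonneg
    (fun _ _ => bernoulliMass_nonneg _ (h _ _))]
  refine Finset.prod_congr rfl fun p _ => ?_
  unfold bernoulliMass
  split_ifs <;> rw [ENNReal.exp_log]

lemma proportion_pos {Q : ℕ} {γ : ℝ} (hγ : 0 < γ) {α : Fin Q → ℝ} (h : α ∈ proportionSet Q γ)
    (q : Fin Q) : 0 < α q := hγ.trans_le (h.2 q).1

lemma lik_nonneg {Q n : ℕ} {θ : (Fin Q → ℝ) × Matrix (Fin Q) (Fin Q) ℝ}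
    (hα : ∀ q, 0 ≤ θ.1 q) (hπ : ∀ q l, θ.2 q l ∈ Set.Icc (0 : ℝ) 1)
    (x : Fin n → Fin n → Bool) : 0 ≤ lik x θ :=
  Finset.sum_nonneg fun z _ =>
    mul_nonneg (condLik_nonneg hπ x z) (Finset.prod_nonneg fun i _ => hα (z i))

lemma logLik_eq {Q n : ℕ} {θ : (Fin Q → ℝ) × Matrix (Fin Q) (Fin Q) ℝ}
    (hα : ∀ q, 0 ≤ θ.1 q) (hπ : ∀ q l, θ.2 q l ∈ Set.Icc (0 : ℝ) 1)
    (x : Fin n → Fin n → Bool) : logLik x θ = ENNReal.log (ENNReal.ofReal (lik x θ)) := by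
  unfold logLik lik
  rw [ENNReal.ofReal_sum_of_nonneg fun z _ =>
    mul_nonneg (condLik_nonneg hπ x z) (Finset.prod_nonneg fun i _ => hα (z i))]
  congr 1
  refine Finset.sum_congr rfl fun z _ => ?_
  rw [exp_condLogLik hπ, ENNReal.ofReal_mul (condLik_nonneg hπ x z),
    ENNReal.ofReal_prod_of_nonneg (fun i _ => hα (z i))]

lemma logLik_le_logLik_iff {Q n : ℕ} {ζ γ : ℝ} (hγ : 0 < γ)
    {θ θ' : (Fin Q → ℝ) × Matrix (Fin Q) (Fin Q) ℝ}
    (hθ : θ ∈ proportionSet Q γ ×ˢ connectivitySet Q ζ)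
    (hθ' : θ' ∈ proportionSet Q γ ×ˢ connectivitySet Q ζ) (x : Fin n → Fin n → Bool) :
    logLik x θ ≤ logLik x θ' ↔ lik x θ ≤ lik x θ' := by
  rw [logLik_eq (fun q => (proportion_pos hγ hθ.1 q).le) hθ.2.1,
    logLik_eq (fun q => (proportion_pos hγ hθ'.1 q).le) hθ'.2.1, ENNReal.log_le_log_iff,
    ENNReal.ofReal_le_ofReal_iff
      (lik_nonneg (fun q => (proportion_pos hγ hθ'.1 q).le) hθ'.2.1 x)]

lemma continuous_lik {Q n : ℕ} (x : Fin n → Fin n → Bool) :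
    Continuous (lik (Q := Q) x) := by
  unfold lik condLik bernoulliMass
  refine continuous_finsetSum _ fun z _ => Continuous.mul
    (continuous_finsetProd _ fun p _ => ?_) (continuous_finsetProd _ fun i _ => by fun_prop)
  split_ifs <;> fun_prop

/-- A likelihood is an average of conditional likelihoods, hence is at most one of them. -/
lemma exists_lik_le_condLik {Q n : ℕ} {θ : (Fin Q → ℝ) × Matrix (Fin Q) (Fin Q) ℝ}
    (hα : ∀ q, 0 ≤ θ.1 q) (hsum : ∑ q, θ.1 q = 1) (x : Fin n → Fin n → Bool) :
    ∃ z : Fin n → Fin Q, lik x θ ≤ condLik x z θ.2 := by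
  have hw : ∑ z : Fin n → Fin Q, ∏ i, θ.1 (z i) = 1 := by
    have h := Finset.prod_univ_sum (fun _ : Fin n => (Finset.univ : Finset (Fin Q)))
      (fun _ q => θ.1 q)
    simpa [hsum] using h.symm
  by_contra! hcon
  have hpos : ∃ z ∈ (Finset.univ : Finset (Fin n → Fin Q)), 0 < ∏ i, θ.1 (z i) := by
    by_contra! h
    linarith [Finset.sum_nonpos h]
  obtain ⟨z, hz, hzpos⟩ := hpos
  have : ∑ z : Fin n → Fin Q, condLik x z θ.2 * ∏ i, θ.1 (z i) <
      ∑ z : Fin n → Fin Q, lik x θ * ∏ i, θ.1 (z i) :=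
    Finset.sum_lt_sum
      (fun z _ => mul_le_mul_of_nonneg_right (hcon z).le (Finset.prod_nonneg fun i _ => hα _))
      ⟨z, hz, mul_lt_mul_of_pos_right (hcon z) hzpos⟩
  rw [← Finset.mul_sum, hw, mul_one] at this
  exact lt_irrefl _ this

lemma pow_mul_condLik_le_lik {Q n : ℕ} {γ : ℝ} (hγ : 0 < γ)
    {θ : (Fin Q → ℝ) × Matrix (Fin Q) (Fin Q) ℝ}
    (hα : ∀ q, γ ≤ θ.1 q) (hπ : ∀ q l, θ.2 q l ∈ Set.Icc (0 : ℝ) 1)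
    (x : Fin n → Fin n → Bool) (z : Fin n → Fin Q) :
    γ ^ n * condLik x z θ.2 ≤ lik x θ := by
  have hα0 : ∀ q, 0 ≤ θ.1 q := fun q => hγ.le.trans (hα q)
  have h1 : γ ^ n ≤ ∏ i, θ.1 (z i) := by
    simpa using Finset.prod_le_prod (s := (Finset.univ : Finset (Fin n))) (f := fun _ => γ)
      (fun _ _ => hγ.le) (fun i _ => hα (z i))
  calc γ ^ n * condLik x z θ.2 ≤ condLik x z θ.2 * ∏ i, θ.1 (z i) := by
        rw [mul_comm]; exact mul_le_mul_of_nonneg_left h1 (condLik_nonneg hπ x z)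
    _ ≤ lik x θ := Finset.single_le_sum
        (f := fun z : Fin n → Fin Q => condLik x z θ.2 * ∏ i, θ.1 (z i))
        (fun z _ => mul_nonneg (condLik_nonneg hπ x z) (Finset.prod_nonneg fun i _ => hα0 (z i)))
        (Finset.mem_univ z)

/-! ### Perturbation of the connectivity matrix -/

/-- Entries closer than `ζ` are both `0`, both `1` or both in `[ζ, 1 - ζ]`, so their Bernoulli
masses have a bounded ratio. -/
lemma bernoulliMass_le_mul {ζ δ a a' : ℝ} (hζ : 0 < ζ) (hδ : 0 < δ) (hδζ : δ ≤ ζ) (hδ1 : δ ≤ 1)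
    (ha : a ∈ ({0, 1} : Set ℝ) ∪ Set.Icc ζ (1 - ζ))
    (ha' : a' ∈ ({0, 1} : Set ℝ) ∪ Set.Icc ζ (1 - ζ)) (h : |a - a'| < δ) (b : Bool) :
    bernoulliMass b a ≤ Real.exp (δ / ζ) * bernoulliMass b a' := by
  have hlip : ∀ t t' : ℝ, |t - t'| < δ → ζ ≤ t' → t ≤ Real.exp (δ / ζ) * t' := by
    intro t t' ht ht'
    have h1 : 1 + δ / ζ ≤ Real.exp (δ / ζ) := by linarith [Real.add_one_le_exp (δ / ζ)]
    have h2 : δ ≤ δ / ζ * t' := by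
      rw [div_mul_eq_mul_div, le_div_iff₀ hζ]; exact mul_le_mul_of_nonneg_left ht' hδ.le
    have h3 := mul_le_mul_of_nonneg_right h1 (hζ.le.trans ht')
    linarith [(abs_lt.1 ht).2]
  have hone : 1 ≤ Real.exp (δ / ζ) := Real.one_le_exp (by positivity)
  have hab := abs_lt.1 h
  have hcase : a = a' ∧ (a' = 0 ∨ a' = 1) ∨ (ζ ≤ a' ∧ ζ ≤ 1 - a') := by
    rcases ha' with (h' | h') | h'
    · left
      rcases ha with (h | h) | h
      · exact ⟨h.trans h'.symm, Or.inl h'⟩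
      · rw [Set.mem_singleton_iff] at h; linarith
      · linarith [h.1]
    · left
      rw [Set.mem_singleton_iff] at h'
      rcases ha with (h | h) | h
      · linarith
      · exact ⟨h.trans h'.symm, Or.inr h'⟩
      · linarith [h.2]
    · exact Or.inr ⟨h'.1, by linarith [h'.2]⟩
  unfold bernoulliMass
  rcases hcase with ⟨rfl, rfl | rfl⟩ | ⟨h1, h2⟩
  · cases b <;> simp [hone]
  · cases b <;> simp [hone]
  · cases b
    · simp only [Bool.false_eq_true, if_false]
      exact hlip _ _ (by rw [abs_lt]; constructor <;> linarith) h2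
    · simpa using hlip _ _ h h1

lemma condLik_le_mul {Q n : ℕ} {ζ δ : ℝ} (hζ : 0 < ζ) (hδ : 0 < δ) (hδζ : δ ≤ ζ) (hδ1 : δ ≤ 1)
    {π π' : Matrix (Fin Q) (Fin Q) ℝ} (hπ : π ∈ relaxedConnectivitySet Q ζ)
    (hπ' : π' ∈ relaxedConnectivitySet Q ζ) (h : ∀ q l, |π q l - π' q l| < δ)
    (x : Fin n → Fin n → Bool) (z : Fin n → Fin Q) :
    condLik x z π ≤ Real.exp (δ / ζ * (n : ℝ) ^ 2) * condLik x z π' := by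
  have hcard : (((Finset.univ : Finset (Fin n)).offDiag.card : ℕ) : ℝ) ≤ (n : ℝ) ^ 2 := by
    have : (Finset.univ : Finset (Fin n)).offDiag.card ≤ n ^ 2 := by
      rw [Finset.offDiag_card, Finset.card_univ, Fintype.card_fin, sq]; omega
    exact_mod_cast this
  calc condLik x z π ≤ ∏ p ∈ (Finset.univ : Finset (Fin n)).offDiag,
        Real.exp (δ / ζ) * bernoulliMass (x p.1 p.2) (π' (z p.1) (z p.2)) :=
      Finset.prod_le_prod
        (fun _ _ => bernoulliMass_nonneg _ (mem_Icc_of_mem_relaxedConnectivitySet hζ hπ _ _))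
        (fun _ _ => bernoulliMass_le_mul hζ hδ hδζ hδ1 (hπ _ _) (hπ' _ _) (h _ _) _)
    _ = Real.exp (δ / ζ * ((Finset.univ : Finset (Fin n)).offDiag.card : ℝ)) *
        condLik x z π' := by
      rw [Finset.prod_mul_distrib, Finset.prod_const, ← Real.exp_nat_mul, mul_comm (δ / ζ)]; rfl
    _ ≤ _ := by
      refine mul_le_mul_of_nonneg_right (Real.exp_le_exp.2 ?_)
        (condLik_nonneg (mem_Icc_of_mem_relaxedConnectivitySet hζ hπ') x z)
      exact mul_le_mul_of_nonneg_left hcard (by positivity)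

/-! ### Hellinger affinities of graph laws -/

/-- The adjacency matrices of the graphs on `n` vertices without loops. -/
def looplessGraphs (n : ℕ) : Finset (Fin n → Fin n → Bool) :=
  Finset.univ.filter fun x => ∀ i, x i i = false

lemma sum_looplessGraphs_prod {n : ℕ} (g : Fin n × Fin n → Bool → ℝ) :
    ∑ x ∈ looplessGraphs n, ∏ p ∈ (Finset.univ : Finset (Fin n)).offDiag, g p (x p.1 p.2) =
      ∏ p ∈ (Finset.univ : Finset (Fin n)).offDiag, (g p true + g p false) := by
  classical
  -- The diagonal gets the single admissible value `false` and the factor `1`.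
  let t : Fin n → Fin n → Finset Bool := fun i j => if i = j then {false} else Finset.univ
  let g' : Fin n → Fin n → Bool → ℝ := fun i j b => if i = j then 1 else g (i, j) b
  have hset : looplessGraphs n = Fintype.piFinset fun i => Fintype.piFinset fun j => t i j := by
    ext x
    simp only [looplessGraphs, Finset.mem_filter, Finset.mem_univ, true_and, Fintype.mem_piFinset,
      t]
    constructor
    · intro h i j
      split_ifs with hij
      · subst hij; simp [h i]
      · simp
    · intro h i
      simpa using h i i
  have hoff : ∀ f : Fin n × Fin n → ℝ, (∏ p ∈ (Finset.univ : Finset (Fin n)).offDiag, f p) =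
      ∏ i, ∏ j, if i = j then 1 else f (i, j) := by
    intro f
    rw [← Finset.prod_product' (f := fun i j => if i = j then 1 else f (i, j))]
    rw [Finset.univ_product_univ,
      ← Finset.prod_subset (Finset.subset_univ (Finset.univ : Finset (Fin n)).offDiag)]
    · refine Finset.prod_congr rfl fun p hp => ?_
      rw [Finset.mem_offDiag] at hp
      rw [if_neg hp.2.2]
    · intro p _ hp
      rw [Finset.mem_offDiag] at hp
      simp only [Finset.mem_univ, true_and, not_not] at hp
      rw [if_pos hp]
  have hsum : ∀ i j, ∑ b ∈ t i j, g' i j b =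
      if i = j then 1 else g (i, j) true + g (i, j) false := by
    intro i j
    by_cases hij : i = j <;> simp [t, g', hij]
  rw [hoff, hset]
  simp_rw [hoff, ← hsum]
  rw [show (∏ i, ∏ j, ∑ b ∈ t i j, g' i j b) =
      ∏ i, ∑ y ∈ Fintype.piFinset (t i), ∏ j, g' i j (y j) from
    Finset.prod_congr rfl fun i _ => Finset.prod_univ_sum _ _]
  rw [Finset.prod_univ_sum]

/-- The Hellinger affinity of two Bernoulli laws is at most `exp (-(a - b)² / 2)`. -/
lemma bernoulli_affinity_le {a b : ℝ} (ha : a ∈ Set.Icc (0 : ℝ) 1) (hb : b ∈ Set.Icc (0 : ℝ) 1) :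
    √(a * b) + √((1 - a) * (1 - b)) ≤ Real.exp (-(1 / 2) * (a - b) ^ 2) := by
  have ha1 : 0 ≤ 1 - a := by linarith [ha.2]
  have hb1 : 0 ≤ 1 - b := by linarith [hb.2]
  have hA := Real.sq_sqrt (mul_nonneg ha.1 hb.1)
  have hB := Real.sq_sqrt (mul_nonneg ha1 hb1)
  have hS := Real.sq_sqrt (mul_nonneg ha.1 hb1)
  have hT := Real.sq_sqrt (mul_nonneg hb.1 ha1)
  set A := √(a * b)
  set B := √((1 - a) * (1 - b))
  set S := √(a * (1 - b)) with hSdef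
  set T := √(b * (1 - a)) with hTdef
  have hA0 : 0 ≤ A := Real.sqrt_nonneg _
  have hB0 : 0 ≤ B := Real.sqrt_nonneg _
  have hABST : A * B = S * T := by
    rw [← Real.sqrt_mul (mul_nonneg ha.1 hb.1), hSdef, hTdef,
      ← Real.sqrt_mul (mul_nonneg ha.1 hb1)]
    congr 1; ring
  -- `(A + B)² = 1 - (S - T)²` and `(S - T)² ≥ (S - T)² (S + T)² = (a - b)²`.
  have h1 : (A + B) ^ 2 = 1 - (S - T) ^ 2 := by nlinarith
  have h2 : (S + T) ^ 2 ≤ 1 := by nlinarith [sq_nonneg (A - B)]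
  have h3 : (a - b) ^ 2 = (S - T) ^ 2 * (S + T) ^ 2 := by
    have : a - b = S ^ 2 - T ^ 2 := by rw [hS, hT]; ring
    rw [this]; ring
  have h4 : (A + B) ^ 2 ≤ 1 - (a - b) ^ 2 := by nlinarith [sq_nonneg (S - T)]
  have h5 : 1 - (a - b) ^ 2 ≤ Real.exp (-(a - b) ^ 2) := by
    linarith [Real.add_one_le_exp (-(a - b) ^ 2)]
  have h6 : Real.exp (-(a - b) ^ 2) = Real.exp (-(1 / 2) * (a - b) ^ 2) ^ 2 := by
    rw [← Real.exp_nat_mul]; congr 1; push_cast; ring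
  exact le_of_sq_le_sq (by linarith) (Real.exp_pos _).le

/-- The Hellinger affinity of the conditional laws of two labelled graphs decays exponentially in
the squared distance between the edge probabilities. -/
lemma sum_sqrt_condLik_mul_le {Q n : ℕ} {π π' : Matrix (Fin Q) (Fin Q) ℝ}
    (hπ : ∀ q l, π q l ∈ Set.Icc (0 : ℝ) 1) (hπ' : ∀ q l, π' q l ∈ Set.Icc (0 : ℝ) 1)
    (z z' : Fin n → Fin Q) :
    ∑ x ∈ looplessGraphs n, √(condLik x z π * condLik x z' π') ≤
      Real.exp (-(1 / 2) * ∑ p ∈ (Finset.univ : Finset (Fin n)).offDiag,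
        (π (z p.1) (z p.2) - π' (z' p.1) (z' p.2)) ^ 2) := by
  have h1 : ∀ x : Fin n → Fin n → Bool, √(condLik x z π * condLik x z' π') =
      ∏ p ∈ (Finset.univ : Finset (Fin n)).offDiag,
        √(bernoulliMass (x p.1 p.2) (π (z p.1) (z p.2)) *
          bernoulliMass (x p.1 p.2) (π' (z' p.1) (z' p.2))) := by
    intro x
    unfold condLik
    rw [← Finset.prod_mul_distrib, Real.sqrt_prod _ fun _ _ =>
      mul_nonneg (bernoulliMass_nonneg _ (hπ _ _)) (bernoulliMass_nonneg _ (hπ' _ _))]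
  simp_rw [h1]
  rw [sum_looplessGraphs_prod (fun p b => √(bernoulliMass b (π (z p.1) (z p.2)) *
    bernoulliMass b (π' (z' p.1) (z' p.2)))), Finset.mul_sum, Real.exp_sum]
  refine Finset.prod_le_prod (fun _ _ => by positivity) fun p _ => ?_
  simpa [bernoulliMass] using bernoulli_affinity_le (hπ _ _) (hπ' _ _)

/-- A Chernoff bound of order `1 / 2`, with a union bound over the labels `z` and the matrices
of `T`: it controls the probability that some competitor has a likelihood larger than the true one
up to the factor `C²`. -/
lemma sum_condLik_filter_le {Q n : ℕ} {πs : Matrix (Fin Q) (Fin Q) ℝ}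
    (hπs : ∀ q l, πs q l ∈ Set.Icc (0 : ℝ) 1) (zs : Fin n → Fin Q)
    (T : Finset (Matrix (Fin Q) (Fin Q) ℝ))
    {C ρ : ℝ} (hC : 0 ≤ C)
    (hρ : ∀ π ∈ T, ∀ z : Fin n → Fin Q,
      ∑ x ∈ looplessGraphs n, √(condLik x z π * condLik x zs πs) ≤ ρ)
    (B : Finset (Fin n → Fin n → Bool)) (hB : B ⊆ looplessGraphs n)
    (hbad : ∀ x ∈ B, ∃ π ∈ T, ∃ z, condLik x zs πs ≤ C ^ 2 * condLik x z π) :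
    ∑ x ∈ B, condLik x zs πs ≤ T.card * (Q : ℝ) ^ n * (C * ρ) := by
  have hpt : ∀ x ∈ B, condLik x zs πs ≤
      ∑ π ∈ T, ∑ z : Fin n → Fin Q, C * √(condLik x z π * condLik x zs πs) := by
    intro x hx
    obtain ⟨π, hπ, z, h⟩ := hbad x hx
    have h0 := condLik_nonneg hπs x zs
    have h1 : condLik x zs πs ≤ C * √(condLik x z π * condLik x zs πs) := by
      calc condLik x zs πs = √(condLik x zs πs * condLik x zs πs) :=
            (Real.sqrt_mul_self h0).symm
        _ ≤ √(C ^ 2 * (condLik x z π * condLik x zs πs)) := Real.sqrt_le_sqrt (by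
            rw [← mul_assoc]; exact mul_le_mul_of_nonneg_right h h0)
        _ = C * √(condLik x z π * condLik x zs πs) := by
            rw [Real.sqrt_mul (sq_nonneg C), Real.sqrt_sq hC]
    have h2 := Finset.single_le_sum (s := Finset.univ)
      (f := fun z : Fin n → Fin Q => C * √(condLik x z π * condLik x zs πs))
      (fun _ _ => by positivity) (Finset.mem_univ z)
    have h3 := Finset.single_le_sum (s := T)
      (f := fun π => ∑ z : Fin n → Fin Q, C * √(condLik x z π * condLik x zs πs))
      (fun _ _ => Finset.sum_nonneg fun _ _ => by positivity) hπ
    exact h1.trans (h2.trans h3)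
  calc ∑ x ∈ B, condLik x zs πs
      ≤ ∑ x ∈ B, ∑ π ∈ T, ∑ z : Fin n → Fin Q, C * √(condLik x z π * condLik x zs πs) :=
        Finset.sum_le_sum hpt
    _ ≤ ∑ x ∈ looplessGraphs n,
          ∑ π ∈ T, ∑ z : Fin n → Fin Q, C * √(condLik x z π * condLik x zs πs) :=
        Finset.sum_le_sum_of_subset_of_nonneg hB fun _ _ _ =>
          Finset.sum_nonneg fun _ _ => Finset.sum_nonneg fun _ _ => by positivity
    _ = ∑ π ∈ T, ∑ z : Fin n → Fin Q,
          C * ∑ x ∈ looplessGraphs n, √(condLik x z π * condLik x zs πs) := by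
        rw [Finset.sum_comm]
        refine Finset.sum_congr rfl fun π _ => ?_
        rw [Finset.sum_comm]
        exact Finset.sum_congr rfl fun z _ => (Finset.mul_sum _ _ _).symm
    _ ≤ ∑ π ∈ T, ∑ z : Fin n → Fin Q, C * ρ :=
        Finset.sum_le_sum fun π hπ => Finset.sum_le_sum fun z _ =>
          mul_le_mul_of_nonneg_left (hρ π hπ z) hC
    _ = T.card * (Q : ℝ) ^ n * (C * ρ) := by
        simp [mul_assoc]

/-! ### Separation of the competitors -/

/-- The labels `z` give each of the classes at least `c * n` vertices. -/
def HasLargeClasses {Q n : ℕ} (c : ℝ) (z : Fin n → Fin Q) : Prop :=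
  ∀ q, c * n ≤ ((Finset.univ.filter fun i => z i = q).card : ℝ)

/-- The matrices which no map between the classes, injective or not, brings `ε`-close to `πs`. -/
def farMatrices {Q : ℕ} (ε : ℝ) (πs : Matrix (Fin Q) (Fin Q) ℝ) :
    Set (Matrix (Fin Q) (Fin Q) ℝ) :=
  {π | ∀ f : Fin Q → Fin Q, ∃ q l, ε ≤ |π (f q) (f l) - πs q l|}

lemma isClosed_farMatrices {Q : ℕ} (ε : ℝ) (πs : Matrix (Fin Q) (Fin Q) ℝ) :
    IsClosed (farMatrices ε πs) := by
  have : farMatrices ε πs = ⋂ f : Fin Q → Fin Q, ⋃ q, ⋃ l,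
      {π : Matrix (Fin Q) (Fin Q) ℝ | ε ≤ |π (f q) (f l) - πs q l|} := by
    ext π; simp [farMatrices]
  rw [this]
  exact isClosed_iInter fun f => isClosed_iUnion_of_finite fun q => isClosed_iUnion_of_finite
    fun l => isClosed_le continuous_const (by fun_prop)

/-- For labels `zs` with large classes, the edge probabilities of a far matrix are at a squared
distance of order `n²` from the true ones, whatever the labels `z`: by the pigeonhole principle,
each true class `q` meets some class `f q` of `z` in a positive fraction of the vertices. -/
lemma le_sum_sq_of_mem_farMatrices {Q n : ℕ} {c ε : ℝ} (hc : 0 ≤ c) (hε : 0 ≤ ε)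
    {π πs : Matrix (Fin Q) (Fin Q) ℝ} (hπ : π ∈ farMatrices ε πs)
    {zs : Fin n → Fin Q} (hzs : HasLargeClasses c zs) (z : Fin n → Fin Q) :
    (ε * (c / Q)) ^ 2 * (n : ℝ) ^ 2 - ε ^ 2 * n ≤
      ∑ p ∈ (Finset.univ : Finset (Fin n)).offDiag,
        (π (z p.1) (z p.2) - πs (zs p.1) (zs p.2)) ^ 2 := by
  classical
  have hpig : ∀ q, ∃ k, c / Q * n ≤
      ((Finset.univ.filter fun i => zs i = q ∧ z i = k).card : ℝ) := by
    intro q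
    by_contra! hcon
    have hQ : 0 < (Q : ℝ) := by exact_mod_cast q.pos
    have h1 : (Finset.univ.filter fun i => zs i = q).card =
        ∑ k, (Finset.univ.filter fun i => zs i = q ∧ z i = k).card := by
      rw [Finset.card_eq_sum_card_fiberwise (f := z) (t := Finset.univ) (by simp [Set.MapsTo])]
      simp only [Finset.filter_filter]
    have h2 : ((Finset.univ.filter fun i => zs i = q).card : ℝ) < ∑ _k : Fin Q, c / Q * n := by
      rw [h1]; push_cast
      exact Finset.sum_lt_sum_of_nonempty ⟨q, Finset.mem_univ q⟩ fun k _ => hcon k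
    have h3 : ∑ _k : Fin Q, c / Q * (n : ℝ) = c * n := by
      simp only [Finset.sum_const, Finset.card_univ, Fintype.card_fin, nsmul_eq_mul]
      field_simp
    linarith [hzs q]
  choose f hf using hpig
  obtain ⟨q, l, hql⟩ := hπ f
  let S : Fin Q → Finset (Fin n) := fun q => Finset.univ.filter fun i => zs i = q ∧ z i = f q
  -- The pairs on the diagonal, at most `n` of them, carry no edge.
  have hcardS : ((S q).card : ℝ) * (S l).card - n ≤
      ((S q ×ˢ S l).filter fun p => p.1 ≠ p.2).card := by
    have h1 := Finset.card_filter_add_card_filter_not (s := S q ×ˢ S l) (fun p => p.1 ≠ p.2)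
    have h2 : ((S q ×ˢ S l).filter fun p => ¬ p.1 ≠ p.2).card ≤ n := by
      calc _ ≤ (Finset.univ : Finset (Fin n)).diag.card := Finset.card_le_card fun p hp => by
            simp only [Finset.mem_filter, not_not] at hp
            simp [Finset.mem_diag, hp.2]
        _ = n := by simp
    rw [Finset.card_product] at h1
    have h1' : (((S q ×ˢ S l).filter fun p => p.1 ≠ p.2).card : ℝ) +
      ((S q ×ˢ S l).filter fun p => ¬ p.1 ≠ p.2).card = (S q).card * (S l).card := by
      exact_mod_cast h1
    have h2' : (((S q ×ˢ S l).filter fun p => ¬ p.1 ≠ p.2).card : ℝ) ≤ n := by exact_mod_cast h2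
    linarith
  have hprod : (c / Q * n) ^ 2 ≤ ((S q).card : ℝ) * (S l).card := by
    rw [sq]; exact mul_le_mul (hf q) (hf l) (by positivity) (by positivity)
  calc (ε * (c / Q)) ^ 2 * (n : ℝ) ^ 2 - ε ^ 2 * n = ((c / Q * n) ^ 2 - n) * ε ^ 2 := by ring
    _ ≤ ((S q ×ˢ S l).filter fun p => p.1 ≠ p.2).card * ε ^ 2 :=
        mul_le_mul_of_nonneg_right (by linarith) (sq_nonneg ε)
    _ = ∑ p ∈ (S q ×ˢ S l).filter fun p => p.1 ≠ p.2, ε ^ 2 := by simp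
    _ ≤ ∑ p ∈ (S q ×ˢ S l).filter fun p => p.1 ≠ p.2,
          (π (z p.1) (z p.2) - πs (zs p.1) (zs p.2)) ^ 2 := by
        refine Finset.sum_le_sum fun p hp => ?_
        simp only [S, Finset.mem_filter, Finset.mem_product, Finset.mem_univ, true_and] at hp
        obtain ⟨⟨⟨h1, h2⟩, h3, h4⟩, -⟩ := hp
        rw [h1, h2, h3, h4, ← sq_abs (π _ _ - _)]
        exact pow_le_pow_left₀ hε hql 2
    _ ≤ _ := Finset.sum_le_sum_of_subset_of_nonneg
        (fun p hp => by
          rw [Finset.mem_filter] at hp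
          simpa [Finset.mem_offDiag] using hp.2)
        fun _ _ _ => sq_nonneg _

/-- A map between the classes which brings `π` close to `πs` is a permutation: it cannot merge
two classes, because their profiles in `πs` differ by at least `η`. -/
lemma exists_perm_of_notMem_farMatrices {Q : ℕ} {ε η : ℝ} (hεη : 2 * ε ≤ η)
    {π πs : Matrix (Fin Q) (Fin Q) ℝ}
    (hη : ∀ q q', q ≠ q' → ∃ l, η ≤ |πs q l - πs q' l| ∨ η ≤ |πs l q - πs l q'|)
    (hπ : π ∉ farMatrices ε πs) :
    ∃ σ : Equiv.Perm (Fin Q), ∀ q l, |π (σ q) (σ l) - πs q l| < ε := by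
  have : ∃ f : Fin Q → Fin Q, ∀ q l, |π (f q) (f l) - πs q l| < ε := by
    simpa [farMatrices] using hπ
  obtain ⟨f, hf⟩ := this
  have hinj : Function.Injective f := by
    intro q q' hqq'
    by_contra hne
    obtain ⟨l, h | h⟩ := hη q q' hne
    · have h1 := abs_lt.1 (hf q l)
      have h2 := abs_lt.1 (hf q' l)
      rw [hqq'] at h1
      have : |πs q l - πs q' l| < 2 * ε := abs_lt.2 ⟨by linarith, by linarith⟩
      linarith
    · have h1 := abs_lt.1 (hf l q)
      have h2 := abs_lt.1 (hf l q')
      rw [hqq'] at h1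
      have : |πs l q - πs l q'| < 2 * ε := abs_lt.2 ⟨by linarith, by linarith⟩
      linarith
  exact ⟨Equiv.ofBijective f (Finite.injective_iff_bijective.1 hinj), hf⟩

/-- A matrix whose classes have distinct profiles has a positive gap between them. -/
lemma exists_profile_gap {Q : ℕ} {πs : Matrix (Fin Q) (Fin Q) ℝ}
    (h : ∀ q q', q ≠ q' → ∃ l, πs q l ≠ πs q' l ∨ πs l q ≠ πs l q') :
    ∃ η > 0, ∀ q q', q ≠ q' → ∃ l, η ≤ |πs q l - πs q' l| ∨ η ≤ |πs l q - πs l q'| := by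
  classical
  have h1 : ∀ᶠ η in 𝓝[>] (0 : ℝ), ∀ q q', q ≠ q' →
      ∃ l, η ≤ |πs q l - πs q' l| ∨ η ≤ |πs l q - πs l q'| := by
    rw [eventually_all]; intro q
    rw [eventually_all]; intro q'
    by_cases hne : q = q'
    · simp [hne]
    obtain ⟨l, hl | hl⟩ := h q q' hne
    · filter_upwards [Ioo_mem_nhdsGT (abs_pos.2 (sub_ne_zero.2 hl))] with η hη _
      exact ⟨l, Or.inl hη.2.le⟩
    · filter_upwards [Ioo_mem_nhdsGT (abs_pos.2 (sub_ne_zero.2 hl))] with η hη _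
      exact ⟨l, Or.inr hη.2.le⟩
  obtain ⟨η, hη, hpos⟩ := (h1.and self_mem_nhdsWithin).exists
  exact ⟨η, hpos, hη⟩

/-! ### Typical labels -/

lemma IsSBM.tendsto_measure_not_hasLargeClasses {Ω : Type*} [MeasurableSpace Ω] {μ : Measure Ω}
    [IsProbabilityMeasure μ] {Q : ℕ} {γ : ℝ} (hγ : 0 < γ) {αs : Fin Q → ℝ}
    {πs : Matrix (Fin Q) (Fin Q) ℝ} (hαs : ∀ q, γ ≤ αs q)
    {Z : ℕ → Ω → Fin Q} {X : ℕ → ℕ → Ω → Bool} (hX : IsSBM μ αs πs Z X) :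
    Tendsto (fun n : ℕ => μ {ω | ¬ HasLargeClasses (γ / 2) (fun i : Fin n => Z i ω)})
      atTop (𝓝 0) := by
  classical
  let f : Fin Q → Fin Q → ℝ := fun q k => if k = q then 1 else 0
  have hfm : ∀ q, Measurable (f q) := fun q => Measurable.of_discrete
  have hmap : ∀ i, μ.map (Z i) = μ.map (Z 0) := by
    intro i
    refine Measure.ext_of_singleton fun q => ?_
    rw [Measure.map_apply (hX.measurable_label i) (measurableSet_singleton q),
      Measure.map_apply (hX.measurable_label 0) (measurableSet_singleton q)]
    exact (hX.label_law i q).trans (hX.label_law 0 q).symm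
  have hident : ∀ i, IdentDistrib (Z i) (Z 0) μ μ := fun i =>
    ⟨(hX.measurable_label i).aemeasurable, (hX.measurable_label 0).aemeasurable, hmap i⟩
  have hfZ : ∀ q i, f q ∘ Z i = Set.indicator {ω | Z i ω = q} 1 := by
    intro q i; ext ω; simp [f, Set.indicator_apply]
  have hms : ∀ q i, MeasurableSet {ω | Z i ω = q} := fun q i =>
    hX.measurable_label i (measurableSet_singleton q)
  have hlln : ∀ q, TendstoInMeasure μ
      (fun (n : ℕ) ω => (∑ i ∈ Finset.range n, (f q ∘ Z i) ω) / n) atTop (fun _ => αs q) := by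
    intro q
    refine tendstoInMeasure_of_tendsto_ae (fun n => ?_) ?_
    · refine Measurable.aestronglyMeasurable ?_
      exact (Finset.measurable_fun_sum _ fun i _ =>
        (hfm q).comp (hX.measurable_label i)).div_const _
    · have h := strong_law_ae_real (μ := μ) (fun i => f q ∘ Z i)
        (by
          rw [hfZ]
          exact (integrable_const (1 : ℝ)).indicator (hms q 0))
        (fun i j hij => (hX.label_indep.indepFun hij).comp (hfm q) (hfm q))
        (fun i => (hident i).comp (hfm q))
      have hexp : μ[f q ∘ Z 0] = αs q := by
        rw [hfZ, integral_indicator_one (hms q 0), Measure.real, hX.label_law,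
          ENNReal.toReal_ofReal (hγ.le.trans (hαs q))]
      rwa [hexp] at h
  have hsum : Tendsto (fun n : ℕ => ∑ q, μ {ω | γ / 2 ≤
      dist ((∑ i ∈ Finset.range n, (f q ∘ Z i) ω) / (n : ℝ)) (αs q)}) atTop (𝓝 0) := by
    have := tendsto_finsetSum (Finset.univ : Finset (Fin Q)) fun q _ =>
      tendstoInMeasure_iff_dist.1 (hlln q) (γ / 2) (half_pos hγ)
    simpa using this
  refine tendsto_of_tendsto_of_tendsto_of_le_of_le tendsto_const_nhds hsum
    (fun _ => zero_le) fun n => ?_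
  refine le_trans (measure_mono fun ω hω => ?_) (measure_iUnion_fintype_le μ fun q => {ω | γ / 2 ≤
      dist ((∑ i ∈ Finset.range n, (f q ∘ Z i) ω) / (n : ℝ)) (αs q)})
  simp only [HasLargeClasses, not_forall, not_le, Set.mem_ofPred_eq] at hω
  obtain ⟨q, hq⟩ := hω
  refine Set.mem_iUnion.2 ⟨q, ?_⟩
  have hcard : ((Finset.univ.filter fun i : Fin n => Z i ω = q).card : ℝ) =
      ∑ i ∈ Finset.range n, (f q ∘ Z i) ω := by
    rw [Finset.sum_range]; simp [f]
  rw [hcard] at hq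
  have hn : 0 < (n : ℝ) := by
    rcases n.eq_zero_or_pos with rfl | hn
    · simp at hq
    · exact_mod_cast hn
  have h1 := (div_lt_iff₀ hn).2 hq
  rw [Set.mem_ofPred_eq, Real.dist_eq, abs_sub_comm]
  exact le_trans (by linarith [hαs q]) (le_abs_self _)

/-! ### The competitors of the true parameter -/

lemma IsSBM.measure_labels_graph_le {Ω : Type*} [MeasurableSpace Ω] {μ : Measure Ω}
    {Q : ℕ} {αs : Fin Q → ℝ} {πs : Matrix (Fin Q) (Fin Q) ℝ}
    (hπs : ∀ q l, πs q l ∈ Set.Icc (0 : ℝ) 1)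
    {Z : ℕ → Ω → Fin Q} {X : ℕ → ℕ → Ω → Bool} (hX : IsSBM μ αs πs Z X)
    {n : ℕ} (zs : Fin n → Fin Q) {B : Finset (Fin n → Fin n → Bool)}
    (hB : B ⊆ looplessGraphs n) :
    μ {ω | (∀ i : Fin n, Z i ω = zs i) ∧ (fun i j : Fin n => X i j ω) ∈ B} ≤
      μ {ω | ∀ i : Fin n, Z i ω = zs i} * ENNReal.ofReal (∑ x ∈ B, condLik x zs πs) := by
  have hsub : {ω | (∀ i : Fin n, Z i ω = zs i) ∧ (fun i j : Fin n => X i j ω) ∈ B} ⊆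
      ⋃ x ∈ B, {ω | (∀ i : Fin n, Z i ω = zs i) ∧ ∀ i j : Fin n, X i j ω = x i j} := by
    rintro ω ⟨h1, h2⟩
    exact Set.mem_iUnion₂.2 ⟨_, h2, h1, fun _ _ => rfl⟩
  refine (measure_mono hsub).trans ((measure_biUnion_finset_le B _).trans (le_of_eq ?_))
  rw [ENNReal.ofReal_sum_of_nonneg fun x _ => condLik_nonneg hπs x zs, Finset.mul_sum]
  refine Finset.sum_congr rfl fun x hx => ?_
  rw [hX.edge_law n zs x (by simpa [looplessGraphs] using hB hx), condLik,
    ENNReal.ofReal_prod_of_nonneg fun _ _ => bernoulliMass_nonneg _ (hπs _ _)]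
  rfl

lemma IsSBM.measure_exists_labels_le {Ω : Type*} [MeasurableSpace Ω] {μ : Measure Ω}
    [IsProbabilityMeasure μ] {Q : ℕ} {αs : Fin Q → ℝ} {πs : Matrix (Fin Q) (Fin Q) ℝ}
    (hπs : ∀ q l, πs q l ∈ Set.Icc (0 : ℝ) 1)
    {Z : ℕ → Ω → Fin Q} {X : ℕ → ℕ → Ω → Bool} (hX : IsSBM μ αs πs Z X)
    {n : ℕ} (P : (Fin n → Fin Q) → Prop) (B : (Fin n → Fin Q) → Finset (Fin n → Fin n → Bool))
    (hB : ∀ zs, B zs ⊆ looplessGraphs n) {r : ℝ}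
    (hr : ∀ zs, P zs → ∑ x ∈ B zs, condLik x zs πs ≤ r) :
    μ {ω | P (fun i : Fin n => Z i ω) ∧
      (fun i j : Fin n => X i j ω) ∈ B (fun i : Fin n => Z i ω)} ≤ ENNReal.ofReal r := by
  classical
  let Zn : Ω → Fin n → Fin Q := fun ω i => Z i ω
  have hZn : Measurable Zn := measurable_pi_lambda _ fun i => hX.measurable_label i
  have hsub : {ω | P (fun i : Fin n => Z i ω) ∧
      (fun i j : Fin n => X i j ω) ∈ B (fun i : Fin n => Z i ω)} ⊆
      ⋃ zs : Fin n → Fin Q, {ω | P zs ∧ ((∀ i : Fin n, Z i ω = zs i) ∧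
        (fun i j : Fin n => X i j ω) ∈ B zs)} := by
    rintro ω ⟨h1, h2⟩
    exact Set.mem_iUnion.2 ⟨Zn ω, h1, fun _ => rfl, h2⟩
  calc _ ≤ ∑ zs : Fin n → Fin Q, μ {ω | P zs ∧ ((∀ i : Fin n, Z i ω = zs i) ∧
        (fun i j : Fin n => X i j ω) ∈ B zs)} :=
        (measure_mono hsub).trans (measure_iUnion_fintype_le μ _)
    _ ≤ ∑ zs : Fin n → Fin Q, μ (Zn ⁻¹' {zs}) * ENNReal.ofReal r := by
        refine Finset.sum_le_sum fun zs _ => ?_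
        by_cases hP : P zs
        · have hpre : {ω | ∀ i : Fin n, Z i ω = zs i} = Zn ⁻¹' {zs} := by
            ext ω; simp [Zn, funext_iff]
          simp only [hP, true_and]
          refine (hX.measure_labels_graph_le hπs zs (hB zs)).trans ?_
          rw [hpre]
          gcongr
          exact hr zs hP
        · simp [hP]
    _ = μ (Zn ⁻¹' (Finset.univ : Finset (Fin n → Fin Q))) * ENNReal.ofReal r := by
        rw [← Finset.sum_mul, sum_measure_preimage_singleton _ fun zs _ =>
          hZn (measurableSet_singleton zs)]
    _ ≤ ENNReal.ofReal r := by simp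

/-- The bound of the union bound: the number `exp (O(n))` of competing labels is beaten by the
affinity `exp (-κ n² / 4)`. -/
lemma tendsto_exp_linear_sub_quadratic (A : ℝ) {κ : ℝ} (hκ : 0 < κ) :
    Tendsto (fun n : ℕ => Real.exp (A * n - κ * (n : ℝ) ^ 2)) atTop (𝓝 0) := by
  refine Real.tendsto_exp_atBot.comp ?_
  have h1 : Tendsto (fun n : ℕ => A - κ * (n : ℝ)) atTop atBot := by
    have := (tendsto_natCast_atTop_atTop (R := ℝ)).const_mul_atTop hκ
    simpa [sub_eq_add_neg] using
      tendsto_atBot_add_const_left _ A (tendsto_neg_atTop_atBot.comp this)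
  have h2 := (tendsto_natCast_atTop_atTop (R := ℝ)).atTop_mul_atBot₀ h1
  refine h2.congr fun n => ?_
  ring

/-- With probability tending to one, no parameter with a far connectivity matrix, even in the
relaxed parameter set, has a likelihood as large as that of the true parameter. -/
lemma IsSBM.exists_events_notMem_farMatrices {Ω : Type*} [MeasurableSpace Ω] {μ : Measure Ω}
    [IsProbabilityMeasure μ] {Q : ℕ} {ζ γ : ℝ} (hζ : 0 < ζ) (hγ : 0 < γ) (hQ : 0 < Q)
    {αs : Fin Q → ℝ} {πs : Matrix (Fin Q) (Fin Q) ℝ} (hαs : αs ∈ proportionSet Q γ)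
    (hπs : πs ∈ relaxedConnectivitySet Q ζ)
    {Z : ℕ → Ω → Fin Q} {X : ℕ → ℕ → Ω → Bool} (hX : IsSBM μ αs πs Z X) {ε : ℝ} (hε : 0 < ε) :
    ∃ A : ℕ → Set Ω, Tendsto (fun n => μ (A n)) atTop (𝓝 0) ∧
      ∀ n, ∀ ω ∉ A n, ∀ θ ∈ proportionSet Q γ ×ˢ relaxedConnectivitySet Q ζ,
        lik (fun i j : Fin n => X i j ω) (αs, πs) ≤ lik (fun i j : Fin n => X i j ω) θ →
          θ.2 ∉ farMatrices ε πs := by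
  classical
  have hQ' : 0 < (Q : ℝ) := by exact_mod_cast hQ
  set κ : ℝ := (ε * (γ / 2 / Q)) ^ 2 with hκdef
  have hκ : 0 < κ := by positivity
  -- The mesh of the net: it costs a factor `exp (δ / ζ * n²)` with `δ / ζ ≤ κ / 2`.
  set δ : ℝ := min (min ζ 1) (ζ * κ / 2) with hδdef
  have hδ : 0 < δ := by positivity
  have hδζ : δ ≤ ζ := (min_le_left _ _).trans (min_le_left _ _)
  have hδ1 : δ ≤ 1 := (min_le_left _ _).trans (min_le_right _ _)
  have hδκ : δ / ζ ≤ κ / 2 := by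
    rw [div_le_iff₀ hζ]; exact (min_le_right _ _).trans (le_of_eq (by ring))
  have h01 := mem_Icc_of_mem_relaxedConnectivitySet hζ hπs
  obtain ⟨T, hTsub, hTcover⟩ := ((isCompact_relaxedConnectivitySet Q ζ).inter_right
    (isClosed_farMatrices ε πs)).elim_nhds_subcover
      (fun π' => {π | ∀ q l, |π q l - π' q l| < δ}) (fun π' _ => by
        refine IsOpen.mem_nhds ?_ (by simp [hδ])
        have : {π : Matrix (Fin Q) (Fin Q) ℝ | ∀ q l, |π q l - π' q l| < δ} =
            ⋂ q, ⋂ l, {π | |π q l - π' q l| < δ} := by ext; simp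
        rw [this]
        exact isOpen_iInter_of_finite fun q => isOpen_iInter_of_finite fun l =>
          isOpen_lt (by fun_prop) continuous_const)
  let C : ℕ → ℝ := fun n => Real.exp (1 / 2 * (δ / ζ * (n : ℝ) ^ 2 - n * Real.log γ))
  let ρ : ℕ → ℝ := fun n => Real.exp (-(1 / 2) * (κ * (n : ℝ) ^ 2 - ε ^ 2 * n))
  let B : (n : ℕ) → (Fin n → Fin Q) → Finset (Fin n → Fin n → Bool) := fun n zs =>
    (looplessGraphs n).filter fun x => ∃ π ∈ T, ∃ z, condLik x zs πs ≤ C n ^ 2 * condLik x z π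
  let r : ℕ → ℝ := fun n => T.card * (Q : ℝ) ^ n * (C n * ρ n)
  let A₁ : ℕ → Set Ω := fun n => {ω | ¬ HasLargeClasses (γ / 2) (fun i : Fin n => Z i ω)}
  let A₂ : ℕ → Set Ω := fun n => {ω | HasLargeClasses (γ / 2) (fun i : Fin n => Z i ω) ∧
      (fun i j : Fin n => X i j ω) ∈ B n (fun i : Fin n => Z i ω)}
  have hr : ∀ n, μ (A₂ n) ≤ ENNReal.ofReal (r n) := by
    intro n
    refine hX.measure_exists_labels_le h01 (HasLargeClasses (γ / 2)) (B n)
      (fun zs => Finset.filter_subset _ _) fun zs hzs => ?_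
    refine sum_condLik_filter_le h01 zs T (Real.exp_pos _).le (fun π hπ z => ?_) (B n zs)
      (Finset.filter_subset _ _) fun x hx => (Finset.mem_filter.1 hx).2
    refine (sum_sqrt_condLik_mul_le (mem_Icc_of_mem_relaxedConnectivitySet hζ (hTsub π hπ).1)
      h01 z zs).trans (Real.exp_le_exp.2 ?_)
    have := le_sum_sq_of_mem_farMatrices (by positivity) hε.le (hTsub π hπ).2 hzs z
    linarith
  have hr0 : Tendsto r atTop (𝓝 0) := by
    have h1 := (tendsto_exp_linear_sub_quadratic
      (Real.log Q + (ε ^ 2 - Real.log γ) / 2) (κ := κ / 4) (by positivity)).const_mul (T.card : ℝ)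
    rw [mul_zero] at h1
    refine squeeze_zero (fun n => by positivity) (fun n => ?_) h1
    have hQn : (Q : ℝ) ^ n = Real.exp (n * Real.log Q) := by
      rw [Real.exp_nat_mul, Real.exp_log hQ']
    simp only [r, C, ρ]
    rw [hQn, mul_assoc, ← Real.exp_add, ← Real.exp_add]
    refine mul_le_mul_of_nonneg_left (Real.exp_le_exp.2 ?_) (by positivity)
    have := mul_le_mul_of_nonneg_right hδκ (sq_nonneg (n : ℝ))
    linarith
  refine ⟨fun n => A₁ n ∪ A₂ n, ?_, ?_⟩
  · have h1 := (hX.tendsto_measure_not_hasLargeClasses hγ fun q => (hαs.2 q).1).add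
      (ENNReal.tendsto_ofReal hr0)
    rw [ENNReal.ofReal_zero, add_zero] at h1
    exact tendsto_of_tendsto_of_tendsto_of_le_of_le tendsto_const_nhds h1 (fun _ => zero_le)
      fun n => (measure_union_le _ _).trans (add_le_add_right (hr n) _)
  · intro n ω hω θ hθ hle hfar
    refine hω (or_iff_not_imp_left.2 fun h1 => ?_)
    have hlarge : HasLargeClasses (γ / 2) (fun i : Fin n => Z i ω) := not_not.1 h1
    refine ⟨hlarge, Finset.mem_filter.2 ⟨?_, ?_⟩⟩
    · simp [looplessGraphs, hX.no_loop]
    obtain ⟨π', hπ'T, hclose⟩ := Set.mem_iUnion₂.1 (hTcover ⟨hθ.2, hfar⟩)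
    obtain ⟨z, hz⟩ := exists_lik_le_condLik (fun q => (proportion_pos hγ hθ.1 q).le) hθ.1.1
      (fun i j : Fin n => X i j ω)
    refine ⟨π', hπ'T, z, ?_⟩
    have h2 := pow_mul_condLik_le_lik hγ (θ := (αs, πs)) (fun q => (hαs.2 q).1) h01
      (fun i j : Fin n => X i j ω) (fun i : Fin n => Z i ω)
    have h3 := condLik_le_mul hζ hδ hδζ hδ1 hθ.2 (hTsub π' hπ'T).1 hclose
      (fun i j : Fin n => X i j ω) z
    have h4 := h2.trans (hle.trans (hz.trans h3))
    have hC : C n ^ 2 = Real.exp (δ / ζ * (n : ℝ) ^ 2) / γ ^ n := by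
      simp only [C]
      rw [← Real.exp_nat_mul, ← Real.exp_log (pow_pos hγ n), ← Real.exp_sub, Real.log_pow]
      congr 1; push_cast; ring
    rw [hC, div_mul_eq_mul_div, le_div_iff₀ (pow_pos hγ n), mul_comm]
    exact h4

/-! ### Existence and consistency of the estimator -/

lemma submatrix_mem_connectivitySet {Q : ℕ} {ζ : ℝ} {π : Matrix (Fin Q) (Fin Q) ℝ}
    (h : π ∈ connectivitySet Q ζ) (σ : Equiv.Perm (Fin Q)) :
    π.submatrix σ σ ∈ connectivitySet Q ζ := by
  refine ⟨fun q l => h.1 _ _, fun q q' hne => ?_, fun q l => h.2.2 _ _⟩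
  obtain ⟨l, hl⟩ := h.2.1 (σ q) (σ q') (σ.injective.ne hne)
  exact ⟨σ.symm l, by simpa using hl⟩

/-- Matrices which are close to `πs` up to a permutation have distinct class profiles. -/
lemma mem_connectivitySet_of_notMem_farMatrices {Q : ℕ} {ζ ε η : ℝ} (hζ : 0 < ζ)
    (hεη : 2 * ε ≤ η) {π πs : Matrix (Fin Q) (Fin Q) ℝ}
    (hη : ∀ q q', q ≠ q' → ∃ l, η ≤ |πs q l - πs q' l| ∨ η ≤ |πs l q - πs l q'|)
    (hπ : π ∈ relaxedConnectivitySet Q ζ) (hfar : π ∉ farMatrices ε πs) :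
    π ∈ connectivitySet Q ζ := by
  refine (mem_connectivitySet_iff hζ).2 ⟨hπ, fun q q' hne => ?_⟩
  obtain ⟨σ, hσ⟩ := exists_perm_of_notMem_farMatrices hεη hη hfar
  obtain ⟨l, hl⟩ := hη (σ.symm q) (σ.symm q') (σ.symm.injective.ne hne)
  refine ⟨σ l, ?_⟩
  by_contra! hcon
  have h1 := fun a => abs_lt.1 (hσ (σ.symm a) l)
  have h2 := fun a => abs_lt.1 (hσ l (σ.symm a))
  simp only [Equiv.apply_symm_apply] at h1 h2
  rcases hl with hl | hl
  · have : |πs (σ.symm q) l - πs (σ.symm q') l| < 2 * ε :=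
      abs_lt.2 ⟨by linarith [h1 q, h1 q', hcon.1], by linarith [h1 q, h1 q', hcon.1]⟩
    linarith
  · have : |πs l (σ.symm q) - πs l (σ.symm q')| < 2 * ε :=
      abs_lt.2 ⟨by linarith [h2 q, h2 q', hcon.2], by linarith [h2 q, h2 q', hcon.2]⟩
    linarith

lemma exists_entrywise_ball_subset {Q : ℕ} {πs : Matrix (Fin Q) (Fin Q) ℝ}
    {U : Set (Matrix (Fin Q) (Fin Q) ℝ)} (hU : U ∈ 𝓝 πs) :
    ∃ ε > 0, ∀ π : Matrix (Fin Q) (Fin Q) ℝ, (∀ q l, |π q l - πs q l| < ε) → π ∈ U := by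
  obtain ⟨ε, hε, hball⟩ := (Metric.mem_nhds_iff (α := Fin Q → Fin Q → ℝ)).1 hU
  refine ⟨ε, hε, fun π h => hball ?_⟩
  exact Metric.mem_ball.2 ((dist_pi_lt_iff hε).2 fun q => (dist_pi_lt_iff hε).2 fun l => h q l)

/-- If the far matrices are excluded, a maximizer over the relaxed (compact) parameter set belongs
to the parameter set. -/
lemma mleSet_nonempty_of_notMem_farMatrices {Q n : ℕ} {ζ γ ε η : ℝ} (hζ : 0 < ζ) (hγ : 0 < γ)
    (hεη : 2 * ε ≤ η) {αs : Fin Q → ℝ} {πs : Matrix (Fin Q) (Fin Q) ℝ}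
    (hη : ∀ q q', q ≠ q' → ∃ l, η ≤ |πs q l - πs q' l| ∨ η ≤ |πs l q - πs l q'|)
    (hαs : αs ∈ proportionSet Q γ) (hπs : πs ∈ connectivitySet Q ζ)
    (x : Fin n → Fin n → Bool)
    (hx : ∀ θ ∈ proportionSet Q γ ×ˢ relaxedConnectivitySet Q ζ,
      lik x (αs, πs) ≤ lik x θ → θ.2 ∉ farMatrices ε πs) :
    (mleSet ζ γ x : Set ((Fin Q → ℝ) × Matrix (Fin Q) (Fin Q) ℝ)).Nonempty := by
  obtain ⟨θ, hθ, hmax⟩ := ((isCompact_proportionSet Q γ).prod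
    (isCompact_relaxedConnectivitySet Q ζ)).exists_isMaxOn
      ⟨(αs, πs), hαs, ((mem_connectivitySet_iff hζ).1 hπs).1⟩ (continuous_lik x).continuousOn
  have hθ' : θ ∈ proportionSet Q γ ×ˢ connectivitySet Q ζ :=
    ⟨hθ.1, mem_connectivitySet_of_notMem_farMatrices hζ hεη hη hθ.2
      (hx θ hθ (hmax ⟨hαs, ((mem_connectivitySet_iff hζ).1 hπs).1⟩))⟩
  exact ⟨θ, hθ', fun θ₁ hθ₁ => (logLik_le_logLik_iff hγ hθ₁ hθ' x).2
    (hmax ⟨hθ₁.1, ((mem_connectivitySet_iff hζ).1 hθ₁.2).1⟩)⟩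

theorem corollary3p1 {Ω : Type*} [MeasurableSpace Ω] (μ : Measure Ω) [IsProbabilityMeasure μ]
    (Q : ℕ) (ζ γ : ℝ) (hζ : 0 < ζ) (hγ : 0 < γ) (hγQ : γ < 1 / (Q : ℝ))
    (αs : Fin Q → ℝ) (πs : Matrix (Fin Q) (Fin Q) ℝ)
    (hαs : αs ∈ proportionSet Q γ) (hπs : πs ∈ connectivitySet Q ζ)
    (Z : ℕ → Ω → Fin Q) (X : ℕ → ℕ → Ω → Bool) (hX : IsSBM μ αs πs Z X) :
    -- a maximum-likelihood estimate exists with probability tending to one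
    Tendsto (fun n : ℕ => μ {ω | (mleSet (Q := Q) ζ γ
      (fun i j : Fin n => X i j ω)).Nonempty}) atTop (𝓝 1) ∧
    -- every choice of the maximum-likelihood estimator is consistent, up to label switching
    ∀ θh : ℕ → Ω → (Fin Q → ℝ) × Matrix (Fin Q) (Fin Q) ℝ,
      (∀ n, ∀ᵐ ω ∂μ, (mleSet (Q := Q) ζ γ (fun i j : Fin n => X i j ω)).Nonempty →
        θh n ω ∈ mleSet ζ γ (fun i j : Fin n => X i j ω)) →
      ∀ d : Matrix (Fin Q) (Fin Q) ℝ → Matrix (Fin Q) (Fin Q) ℝ → ℝ,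
        IsDistanceOn (connectivitySet Q ζ) d →
        ContinuousOn (Function.uncurry d) (connectivitySet Q ζ ×ˢ connectivitySet Q ζ) →
        TendstoInMeasure μ
          (fun n ω => ⨅ σ : Equiv.Perm (Fin Q), d ((θh n ω).2.submatrix σ σ) πs)
          atTop (fun _ => 0) := by
  have hQ : 0 < Q := by
    rcases Q.eq_zero_or_pos with rfl | h
    · norm_num at hγQ; linarith
    · exact h
  have hπs' := ((mem_connectivitySet_iff hζ).1 hπs).1
  obtain ⟨η, hη0, hη⟩ := exists_profile_gap hπs.2.1
  refine ⟨?_, fun θh hθh d hd hcont => ?_⟩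
  · obtain ⟨A, hA, hgood⟩ :=
      hX.exists_events_notMem_farMatrices hζ hγ hQ hαs hπs' (half_pos hη0)
    have h1 : Tendsto (fun n => 1 - μ (A n)) atTop (𝓝 1) := by
      simpa using ENNReal.Tendsto.sub (tendsto_const_nhds (x := (1 : ENNReal))) hA (by simp)
    refine tendsto_of_tendsto_of_tendsto_of_le_of_le h1 tendsto_const_nhds (fun n => ?_)
      fun n => prob_le_one
    rw [tsub_le_iff_right, ← measure_univ (μ := μ)]
    refine (measure_mono fun ω _ => ?_).trans (measure_union_le _ _)
    by_cases hω : ω ∈ A n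
    · exact Or.inr hω
    · exact Or.inl (mleSet_nonempty_of_notMem_farMatrices hζ hγ (by linarith) hη hαs hπs _
        (hgood n ω hω))
  · rw [tendstoInMeasure_iff_dist]
    intro e he
    have hcont' : ContinuousWithinAt (fun π => d π πs) (connectivitySet Q ζ) πs :=
      (hcont (πs, πs) ⟨hπs, hπs⟩).comp (f := fun π => (π, πs))
        (by fun_prop) fun π hπ => ⟨hπ, hπs⟩
    have hev : ∀ᶠ π in 𝓝[connectivitySet Q ζ] πs, d π πs < e :=
      hcont'.eventually_lt_const (((hd.eq_zero_iff πs hπs πs hπs).2 rfl).trans_lt he)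
    obtain ⟨ε₀, hε₀, hball⟩ := exists_entrywise_ball_subset (mem_nhdsWithin_iff_eventually.1 hev)
    have hε : 0 < min ε₀ (η / 2) := lt_min hε₀ (half_pos hη0)
    have hεη : 2 * min ε₀ (η / 2) ≤ η := by linarith [min_le_right ε₀ (η / 2)]
    obtain ⟨A, hA, hgood⟩ := hX.exists_events_notMem_farMatrices hζ hγ hQ hαs hπs' hε
    refine tendsto_of_tendsto_of_tendsto_of_le_of_le tendsto_const_nhds hA
      (fun _ => zero_le) fun n => measure_mono_ae ?_
    filter_upwards [hθh n] with ω hω hdist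
    by_contra hωA
    have hmle := hω (mleSet_nonempty_of_notMem_farMatrices hζ hγ hεη hη hαs hπs _
      (hgood n ω hωA))
    have hle := (logLik_le_logLik_iff hγ (θ := (αs, πs)) ⟨hαs, hπs⟩ hmle.1 _).1
      (hmle.2 (αs, πs) ⟨hαs, hπs⟩)
    have hfar := hgood n ω hωA _ ⟨hmle.1.1, ((mem_connectivitySet_iff hζ).1 hmle.1.2).1⟩ hle
    obtain ⟨σ, hσ⟩ := exists_perm_of_notMem_farMatrices hεη hη hfar
    have hlt : d ((θh n ω).2.submatrix σ σ) πs < e :=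
      hball _ (fun q l => (hσ q l).trans_le (min_le_left _ _))
        (submatrix_mem_connectivitySet hmle.1.2 σ)
    have h0 : 0 ≤ ⨅ σ : Equiv.Perm (Fin Q), d ((θh n ω).2.submatrix σ σ) πs :=
      Real.iInf_nonneg fun σ => hd.nonneg _ (submatrix_mem_connectivitySet hmle.1.2 σ) _ hπs
    have h1 : ⨅ σ : Equiv.Perm (Fin Q), d ((θh n ω).2.submatrix σ σ) πs ≤
        d ((θh n ω).2.submatrix σ σ) πs := ciInf_le (Set.finite_range _).bddBelow σ
    have h2 : e ≤ dist (⨅ σ : Equiv.Perm (Fin Q), d ((θh n ω).2.submatrix σ σ) πs) 0 := hdist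
    rw [Real.dist_eq, sub_zero, abs_of_nonneg h0] at h2
    linarith
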